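/- All digraphs are finite, nonempty and without loops. A digraph is strongly connected if for all vertices $u,v$ there is a directed path from $u$ to $v$; $d(u,v)$ is the length of a shortest such path, $\mathcal D=[d(v_i,v_j)]$ is the distance matrix, the diameter is the largest distance, and the girth is the minimum length of a directed cycle ($\infty$ if there is none). $\Gamma'$ is $t'$-transmission regular if $\sum_{v} d(u,v)=t'$ for every vertex $u$. For a real square matrix $M$, $\operatorname{spec}(M)$ is the multiset of its complex eigenvalues with algebraic multiplicity, $ES_M(z)\subseteq\mathbb C^m$ is the eigenspace for $z$ ($m$ being the order of $M$), and $\operatorname{gmult}_M(z)=\dim ES_M(z)$ (which is $0$ if $z$ is not an eigenvalue); $\operatorname{spec}_{\mathcal D}(\Gamma)=\operatorname{spec}(\mathcal D(\Gamma))$. The lexicographic product $\Gamma\circ\Gamma'$ has vertex set $V(\Gamma)\times V(\Gamma')$ and an arc from $(x,x')$ to $(y,y')$ if and only if $(x,y)$ is an arc of $\Gamma$, or $x=y$ and $(x',y')$ is an arc of $\Gamma'$. Let $\Gamma$ and $\Gamma'$ be strongly connected digraphs of orders $n$ and $n'$, respectively, such that $\Gamma'$ is $t'$-transmission regular and $\operatorname{diam}\Gamma'\le\operatorname{girth}\Gamma$.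 Then $\Gamma\circ\Gamma'$ is strongly connected and $$\mathcal D(\Gamma\circ\Gamma')=\mathcal D(\Gamma)\otimes \mathbb J_{n'}+\mathbb I_n\otimes\mathcal D(\Gamma'),$$ where $\mathbb J_{n'}$ is the $n'\times n'$ all ones matrix, $\mathbb I_n$ is the identity matrix and vertices are ordered lexicographically. Moreover $t'$ is an eigenvalue of $\mathcal D(\Gamma')$; writing $\operatorname{spec}_{\mathcal D}(\Gamma)=\{\partial_1,\dots,\partial_n\}$ and $\operatorname{spec}_{\mathcal D}(\Gamma')=\{t',\partial'_2,\dots,\partial'_{n'}\}$ as multisets, we have $$\operatorname{spec}_{\mathcal D}(\Gamma\circ\Gamma')=\{n'\partial_i+t' : i=1,\dots,n\}\cup\{{\partial'_j}^{(n)} : j=2,\dots,n'\}$$ as multisets, where $\cup$ adds multiplicities and the superscript $(n)$ means that each $\partial'_j$ is repeated $n$ times. Given $z\in\mathbb C$, put $\tilde z=\frac{z-t'}{n'}$, $g=\operatorname{gmult}_{\mathcal D(\Gamma)}(\tilde z)$, $g'=\operatorname{gmult}_{\mathcal D(\Gamma')}(z)$ and $S'=\operatorname{spec}_{\mathcal D}(\Gamma')\setminus\{t'\}=\{\partial'_2,\dots,\partial'_{n'}\}$,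 and let $\mathbf 1_{n'}$ be the all ones vector. Then $$\operatorname{gmult}_{\mathcal D(\Gamma\circ\Gamma')}(z)=\begin{cases} g & \text{if } z\notin S',\ \tilde z\in\operatorname{spec}_{\mathcal D}(\Gamma);\\ ng' & \text{if } z\in S',\ \tilde z\notin\operatorname{spec}_{\mathcal D}(\Gamma);\\ ng'+g & \text{if } z\in S',\ \tilde z\in\operatorname{spec}_{\mathcal D}(\Gamma),\ ES_{\mathcal D(\Gamma')}(z)\perp\mathbf 1_{n'};\\ ng' & \text{if } z\in S',\ \tilde z\in\operatorname{spec}_{\mathcal D}(\Gamma),\ ES_{\mathcal D(\Gamma')}(z)\not\perp\mathbf 1_{n'};\\ 0 & \text{otherwise.}\end{cases}$$ -/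

import Mathlib

open scoped Kronecker

noncomputable section

namespace Digraph

variable {V V' : Type*}

/-- The digraph has no loops, i.e. arcs are ordered pairs of distinct vertices. -/
def Loopless (Γ : Digraph V) : Prop := ∀ v, ¬ Γ.Adj v v

/-- `Γ.HasDipath u v k`: there is a dipath with `k` arcs from `u` to `v`, that is, a sequence
`u = w 0, w 1, …, w k = v` of vertices such that each `(w i, w (i + 1))`, `i < k`, is an arc.
(Values of `w` beyond `k` are irrelevant.) -/
def HasDipath (Γ : Digraph V) (u v : V) (k : ℕ) : Prop :=
  ∃ w : ℕ → V, w 0 = u ∧ w k = v ∧ ∀ i < k, Γ.Adj (w i) (w (i + 1))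

/-- `Γ.HasDicycle k`: there is a nontrivial dicycle of length `k`, that is, a closed dipath with
`k ≥ 1` arcs whose vertices `w 0, …, w (k - 1)` are distinct. -/
def HasDicycle (Γ : Digraph V) (k : ℕ) : Prop :=
  0 < k ∧ ∃ w : ℕ → V, w k = w 0 ∧ (∀ i < k, ∀ j < k, w i = w j → i = j) ∧
    ∀ i < k, Γ.Adj (w i) (w (i + 1))

/-- A (nonempty) digraph is strongly connected if there is a dipath from every vertex to every
vertex. -/
def StronglyConnected (Γ : Digraph V) : Prop :=
  Nonempty V ∧ ∀ u v : V, ∃ k, Γ.HasDipath u v k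

/-- The distance from `u` to `v`: the length of a shortest dipath, `⊤` if there is none. -/
def edist (Γ : Digraph V) (u v : V) : ℕ∞ := ⨅ (k : ℕ) (_ : Γ.HasDipath u v k), (k : ℕ∞)

/-- The distance as a natural number (used for strongly connected digraphs, where it is finite). -/
def dist (Γ : Digraph V) (u v : V) : ℕ := (Γ.edist u v).toNat

/-- The diameter: the largest distance between two vertices. -/
def ediam (Γ : Digraph V) : ℕ∞ := ⨆ (u : V) (v : V), Γ.edist u v

/-- The girth: the minimum length of a dicycle, `⊤` if there is none. -/
def egirth (Γ : Digraph V) : ℕ∞ := ⨅ (k : ℕ) (_ : Γ.HasDicycle k), (k : ℕ∞)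

/-- The transmission of `u`: the sum of the distances from `u` to all vertices. -/
def transmission [Fintype V] (Γ : Digraph V) (u : V) : ℕ := ∑ v, Γ.dist u v

/-- A digraph is `t`-transmission regular if every vertex has transmission `t`. -/
def IsTransmissionRegular [Fintype V] (Γ : Digraph V) (t : ℕ) : Prop :=
  ∀ u, Γ.transmission u = t

/-- The distance matrix. -/
def distMatrix (Γ : Digraph V) : Matrix V V ℝ := Matrix.of fun u v => (Γ.dist u v : ℝ)

/-- The lexicographic product of two digraphs. -/
def lexProd (Γ : Digraph V) (Γ' : Digraph V') : Digraph (V × V') where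
  Adj p q := Γ.Adj p.1 q.1 ∨ (p.1 = q.1 ∧ Γ'.Adj p.2 q.2)

end Digraph

namespace RealMatrix

variable {n : Type*} [Fintype n] [DecidableEq n]

/-- A real matrix viewed as a complex matrix. -/
def toComplex (M : Matrix n n ℝ) : Matrix n n ℂ := M.map (fun x : ℝ => (x : ℂ))

/-- The spectrum: the multiset of complex eigenvalues, counted with algebraic multiplicity. -/
def spec (M : Matrix n n ℝ) : Multiset ℂ := (toComplex M).charpoly.roots

/-- The (complex) eigenspace of a real matrix relative to `z`. -/
def eigenspace (M : Matrix n n ℝ) (z : ℂ) : Submodule ℂ (n → ℂ) :=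
  Module.End.eigenspace (Matrix.toLin' (toComplex M)) z

/-- The geometric multiplicity of `z`. -/
def gmult (M : Matrix n n ℝ) (z : ℂ) : ℕ := Module.finrank ℂ (eigenspace M z)

/-- Every vector of the subspace `S` is orthogonal to the all ones vector, with respect to the
standard Hermitian inner product. -/
def PerpOnes (S : Submodule ℂ (n → ℂ)) : Prop := ∀ v ∈ S, star v ⬝ᵥ (1 : n → ℂ) = 0

/-- The all ones matrix. -/
def allOnes (n : Type*) : Matrix n n ℝ := Matrix.of fun _ _ => 1

end RealMatrix

end

/-! A dipath of the product either stays in one copy of `Γ'` or projects to a nonempty dipath of `Γ`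
that is no longer. Between distinct copies only `Γ` counts, since the last `Γ`-arc may end at any
second coordinate. Inside a copy, a detour projects to a closed dipath, of length at least the girth
and so at least the diameter of `Γ'`: it saves nothing. This gives the matrix D ⊗ J + I ⊗ B, with B1
= t1.

Spectrum: BJ = tJ yields (I ⊗ (z - B))((z - t)I - D ⊗ J) = (z - t)(zI - D ⊗ J - I ⊗ B). Take
determinants; D ⊗ J has, up to powers of X, the characteristic polynomial of n'D.

Eigenspaces: with s the vector of block sums of x, the blocks satisfy (B - z)x_i = -(Ds)_i 1. For z
≠ t this means x_i = c_i 1 + y_i with y_i in E = ES_B(z) and (D - z̃)c + Dσ(y)/n' = 0, where σ takes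
block sums. The dimension follows from the rank of this condition
(`gmult_kronecker_add_add_finrank_range`). For z = t a maximum principle makes every block constant;
it also makes t a simple eigenvalue of B (`count_spec_rowSum`), so t' ∉ S'. -/

/-! ### Dipaths and distances in the lexicographic product -/

namespace Digraph

variable {V V' : Type*} {Γ : Digraph V} {Γ' : Digraph V'}

theorem HasDipath.refl (u : V) : Γ.HasDipath u u 0 := ⟨fun _ => u, rfl, rfl, by simp⟩

theorem HasDipath.map {f : V → V'} (hf : ∀ a b, Γ.Adj a b → Γ'.Adj (f a) (f b)) {u v : V} {k : ℕ}
    (h : Γ.HasDipath u v k) : Γ'.HasDipath (f u) (f v) k := by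
  obtain ⟨w, rfl, rfl, h⟩ := h
  exact ⟨f ∘ w, rfl, rfl, fun i hi => hf _ _ (h i hi)⟩

theorem HasDipath.snoc {u v x : V} {k : ℕ} (h : Γ.HasDipath u v k) (hx : Γ.Adj v x) :
    Γ.HasDipath u x (k + 1) := by
  obtain ⟨w, rfl, rfl, h⟩ := h
  refine ⟨fun i => if i ≤ k then w i else x, by simp, by simp, fun i hi => ?_⟩
  rcases Nat.lt_succ_iff_lt_or_eq.mp hi with hi | rfl
  · simpa [hi.le, Nat.succ_le_iff.mpr hi] using h i hi
  · simpa using hx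

theorem hasDipath_zero_iff {u v : V} : Γ.HasDipath u v 0 ↔ u = v := by
  constructor
  · rintro ⟨w, rfl, rfl, -⟩
    rfl
  · rintro rfl
    exact HasDipath.refl _

theorem hasDipath_succ_iff {u v : V} {k : ℕ} :
    Γ.HasDipath u v (k + 1) ↔ ∃ x, Γ.HasDipath u x k ∧ Γ.Adj x v := by
  constructor
  · rintro ⟨w, rfl, rfl, h⟩
    exact ⟨w k, ⟨w, rfl, rfl, fun i hi => h i (by omega)⟩, h k (by omega)⟩
  · rintro ⟨x, h, hx⟩
    exact h.snoc hx

theorem HasDipath.edist_le {u v : V} {k : ℕ} (h : Γ.HasDipath u v k) : Γ.edist u v ≤ k :=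
  iInf₂_le k h

theorem HasDipath.dist_le {u v : V} {k : ℕ} (h : Γ.HasDipath u v k) : Γ.dist u v ≤ k :=
  ENat.toNat_le_of_le_natCast h.edist_le

theorem le_edist {u v : V} {d : ℕ} (h : ∀ k, Γ.HasDipath u v k → d ≤ k) : (d : ℕ∞) ≤ Γ.edist u v :=
  le_iInf₂ fun k hk => by exact_mod_cast h k hk

theorem edist_eq {u v : V} {d : ℕ} (hd : Γ.HasDipath u v d) (h : ∀ k, Γ.HasDipath u v k → d ≤ k) :
    Γ.edist u v = d :=
  le_antisymm hd.edist_le (le_edist h)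

theorem dist_eq {u v : V} {d : ℕ} (hd : Γ.HasDipath u v d) (h : ∀ k, Γ.HasDipath u v k → d ≤ k) :
    Γ.dist u v = d := by
  rw [dist, edist_eq hd h, ENat.toNat_natCast]

theorem StronglyConnected.edist_eq_dist_and_hasDipath (hc : Γ.StronglyConnected) (u v : V) :
    Γ.edist u v = Γ.dist u v ∧ Γ.HasDipath u v (Γ.dist u v) := by
  classical
  have h := hc.2 u v
  have hd := Nat.find_spec h
  have hmin : ∀ k, Γ.HasDipath u v k → Nat.find h ≤ k := fun k hk => Nat.find_min' h hk
  rw [dist_eq hd hmin]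
  exact ⟨edist_eq hd hmin, hd⟩

theorem StronglyConnected.hasDipath_dist (hc : Γ.StronglyConnected) (u v : V) :
    Γ.HasDipath u v (Γ.dist u v) :=
  (hc.edist_eq_dist_and_hasDipath u v).2

theorem StronglyConnected.coe_dist (hc : Γ.StronglyConnected) (u v : V) :
    (Γ.dist u v : ℕ∞) = Γ.edist u v :=
  (hc.edist_eq_dist_and_hasDipath u v).1.symm

theorem dist_self (u : V) : Γ.dist u u = 0 :=
  Nat.le_zero.mp (HasDipath.refl u).dist_le

theorem StronglyConnected.dist_pos (hc : Γ.StronglyConnected) {u v : V} (huv : u ≠ v) :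
    0 < Γ.dist u v := by
  refine Nat.pos_of_ne_zero fun h => huv ?_
  have := hc.hasDipath_dist u v
  rwa [h, hasDipath_zero_iff] at this

/-- A shortest closed dipath with at least one arc is a dicycle. -/
theorem HasDipath.egirth_le {u : V} {k : ℕ} (h : Γ.HasDipath u u k) (hk : 0 < k) :
    Γ.egirth ≤ k := by
  classical
  have hex : ∃ k, 0 < k ∧ ∃ u, Γ.HasDipath u u k := ⟨k, hk, u, h⟩
  obtain ⟨hpos, x, w, hw0, hwk, hadj⟩ := Nat.find_spec hex
  have hle : Nat.find hex ≤ k := Nat.find_min' hex ⟨hk, u, h⟩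
  set m := Nat.find hex with hm
  -- A repeated vertex would cut out a shorter closed dipath, against the minimality of `m` over all
  -- base points.
  have key : ∀ i j, i < j → j < m → w i ≠ w j := by
    intro i j hij hj hw
    refine Nat.find_min hex (m := j - i) (by omega) ⟨by omega, w i, fun l => w (i + l), rfl, ?_, ?_⟩
    · simp only [hw]
      congr 1
      omega
    · intro l hl
      exact hadj (i + l) (by omega)
  refine (iInf₂_le m ⟨hpos, w, hwk.trans hw0.symm, fun i hi j hj hij => ?_, hadj⟩).trans
    (by exact_mod_cast hle)
  rcases lt_trichotomy i j with h | h | h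
  · exact (key i j h hj hij).elim
  · exact h
  · exact (key j i h hi hij.symm).elim

theorem HasDipath.lexProd_fiber {x' y' : V'} {k : ℕ} (x : V) (h : Γ'.HasDipath x' y' k) :
    (Γ.lexProd Γ').HasDipath (x, x') (x, y') k :=
  h.map (f := fun a => (x, a)) fun _ _ hab => Or.inr ⟨rfl, hab⟩

theorem HasDipath.lexProd_of_pos {x y : V} {k : ℕ} (h : Γ.HasDipath x y k) (hk : 0 < k)
    (x' y' : V') : (Γ.lexProd Γ').HasDipath (x, x') (y, y') k := by
  obtain ⟨k, rfl⟩ := Nat.exists_eq_succ_of_ne_zero hk.ne'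
  obtain ⟨w, hw, hwy⟩ := hasDipath_succ_iff.mp h
  exact (hw.map (f := fun a => (a, x')) (Γ' := Γ.lexProd Γ') fun _ _ hab => Or.inl hab).snoc
    (Or.inl hwy)

/-- Projecting to `Γ` forgets the arcs inside copies of `Γ'`; `j` counts the arcs that remain. -/
theorem HasDipath.of_lexProd {p q : V × V'} {k : ℕ} (h : (Γ.lexProd Γ').HasDipath p q k) :
    (p.1 = q.1 ∧ Γ'.HasDipath p.2 q.2 k) ∨ ∃ j, 0 < j ∧ j ≤ k ∧ Γ.HasDipath p.1 q.1 j := by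
  induction k generalizing q with
  | zero =>
    rw [hasDipath_zero_iff] at h
    subst h
    exact Or.inl ⟨rfl, .refl _⟩
  | succ k ih =>
    obtain ⟨w, hw, hwq⟩ := hasDipath_succ_iff.mp h
    rcases ih hw with ⟨h1, h2⟩ | ⟨j, hj0, hjk, hj⟩ <;> rcases hwq with ha | ⟨he, ha⟩
    · exact Or.inr ⟨1, one_pos, by omega, hasDipath_succ_iff.mpr
        ⟨w.1, hasDipath_zero_iff.mpr h1, ha⟩⟩
    · exact Or.inl ⟨h1.trans he, h2.snoc ha⟩
    · exact Or.inr ⟨j + 1, by omega, by omega, hj.snoc ha⟩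
    · exact Or.inr ⟨j, hj0, by omega, he ▸ hj⟩

theorem StronglyConnected.lexProd (hc : Γ.StronglyConnected) (hc' : Γ'.StronglyConnected) :
    (Γ.lexProd Γ').StronglyConnected := by
  have := hc.1
  have := hc'.1
  refine ⟨inferInstance, fun ⟨x, x'⟩ ⟨y, y'⟩ => ?_⟩
  by_cases hxy : x = y
  · subst hxy
    exact ⟨_, (hc'.hasDipath_dist x' y').lexProd_fiber x⟩
  · exact ⟨_, (hc.hasDipath_dist x y).lexProd_of_pos (hc.dist_pos hxy) x' y'⟩

theorem dist_lexProd_of_ne (hc : Γ.StronglyConnected) {x y : V} (hxy : x ≠ y) (x' y' : V') :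
    (Γ.lexProd Γ').dist (x, x') (y, y') = Γ.dist x y := by
  refine dist_eq ((hc.hasDipath_dist x y).lexProd_of_pos (hc.dist_pos hxy) x' y') fun k hk => ?_
  rcases hk.of_lexProd with ⟨h, -⟩ | ⟨j, -, hjk, hj⟩
  · exact (hxy h).elim
  · exact hj.dist_le.trans hjk

theorem dist_lexProd_self (hc' : Γ'.StronglyConnected) (hdiam : Γ'.ediam ≤ Γ.egirth) (x : V)
    (x' y' : V') : (Γ.lexProd Γ').dist (x, x') (x, y') = Γ'.dist x' y' := by
  refine dist_eq ((hc'.hasDipath_dist x' y').lexProd_fiber x) fun k hk => ?_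
  rcases hk.of_lexProd with ⟨-, h⟩ | ⟨j, hj0, hjk, hj⟩
  · exact h.dist_le
  · refine le_trans ?_ hjk
    have h1 : Γ'.edist x' y' ≤ Γ'.ediam := le_iSup₂ (f := fun u v => Γ'.edist u v) x' y'
    have h2 := (h1.trans hdiam).trans (hj.egirth_le hj0)
    rw [← hc'.coe_dist] at h2
    exact_mod_cast h2

theorem distMatrix_lexProd [DecidableEq V] (hc : Γ.StronglyConnected) (hc' : Γ'.StronglyConnected)
    (hdiam : Γ'.ediam ≤ Γ.egirth) :
    (Γ.lexProd Γ').distMatrix =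
      Γ.distMatrix ⊗ₖ RealMatrix.allOnes V' + (1 : Matrix V V ℝ) ⊗ₖ Γ'.distMatrix := by
  ext ⟨x, x'⟩ ⟨y, y'⟩
  by_cases hxy : x = y
  · subst hxy
    simp [distMatrix, RealMatrix.allOnes, dist_lexProd_self hc' hdiam, dist_self]
  · simp [distMatrix, RealMatrix.allOnes, dist_lexProd_of_ne hc hxy, hxy]

end Digraph

/-! ### Characteristic polynomial of D ⊗ J + I ⊗ B -/

namespace RealMatrix
open Polynomial Matrix

theorem toComplex_kronecker_add {m m' : Type*} [DecidableEq m]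
    (D : Matrix m m ℝ) (B : Matrix m' m' ℝ) :
    toComplex (D ⊗ₖ allOnes m' + (1 : Matrix m m ℝ) ⊗ₖ B) =
      toComplex D ⊗ₖ (Matrix.of fun _ _ => 1) + (1 : Matrix m m ℂ) ⊗ₖ toComplex B := by
  ext ⟨i, i'⟩ ⟨j, j'⟩
  by_cases h : i = j <;> simp [toComplex, allOnes, h]

variable {m m' : Type*} [Fintype m] [DecidableEq m] [Fintype m'] [DecidableEq m']

theorem eval_charpoly_smul_eq_prod (A : Matrix m m ℂ) {c : ℂ} (hc : c ≠ 0) (w : ℂ) :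
    (c • A).charpoly.eval w = (A.charpoly.roots.map fun d => w - c * d).prod := by
  have hcard : A.charpoly.roots.card = Fintype.card m := by
    rw [← (IsAlgClosed.splits A.charpoly).natDegree_eq_card_roots, A.charpoly_natDegree_eq_dim]
  have h : Matrix.scalar m w - c • A = c • (Matrix.scalar m (w / c) - A) := by
    rw [smul_sub]
    congr 1
    ext i j
    by_cases hij : i = j <;> simp [hij, mul_div_cancel₀ _ hc]
  rw [Matrix.eval_charpoly, h, Matrix.det_smul, ← Matrix.eval_charpoly,
    (IsAlgClosed.splits A.charpoly).eval_eq_prod_roots_of_monic A.charpoly_monic,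
    ← hcard, ← Multiset.prod_replicate, ← Multiset.map_const', ← Multiset.prod_map_mul]
  simp only [mul_sub, mul_div_cancel₀ _ hc]

/-- D ⊗ J factors as PQ through the space of block sums, and PQ and QP have the same characteristic
polynomial up to powers of X. -/
theorem charpoly_kronecker_ones (D : Matrix m m ℂ) :
    X ^ Fintype.card m * (D ⊗ₖ (Matrix.of fun _ _ => 1 : Matrix m' m' ℂ)).charpoly =
      X ^ Fintype.card (m × m') * ((Fintype.card m' : ℂ) • D).charpoly := by
  let P : Matrix (m × m') m ℂ := Matrix.of fun p v => D p.1 v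
  let Q : Matrix m (m × m') ℂ := Matrix.of fun v p => if v = p.1 then 1 else 0
  have hPQ : P * Q = D ⊗ₖ (Matrix.of fun _ _ => 1 : Matrix m' m' ℂ) := by
    ext ⟨i, i'⟩ ⟨j, j'⟩
    simp [P, Q, Matrix.mul_apply]
  have hQP : Q * P = (Fintype.card m' : ℂ) • D := by
    ext i j
    simp [P, Q, Matrix.mul_apply, Fintype.sum_prod_type]
  rw [← hPQ, ← hQP]
  exact Matrix.charpoly_mul_comm' P Q

theorem eval_charpoly_kronecker_add (D : Matrix m m ℂ) {B : Matrix m' m' ℂ} {t : ℂ}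
    (hB : B *ᵥ 1 = t • (1 : m' → ℂ)) {z : ℂ} (hz : z ≠ t) :
    (z - t) ^ Fintype.card m *
      (D ⊗ₖ (Matrix.of fun _ _ => 1) + (1 : Matrix m m ℂ) ⊗ₖ B).charpoly.eval z =
      B.charpoly.eval z ^ Fintype.card m *
        ((Fintype.card m' : ℂ) • D).charpoly.eval (z - t) := by
  set J : Matrix m' m' ℂ := Matrix.of fun _ _ => 1 with hJ
  have hBJ : B * J = t • J := by
    ext i j
    have := congrFun hB i
    simpa [Matrix.mul_apply, hJ, Matrix.mulVec, dotProduct] using this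
  have hfac : ((1 : Matrix m m ℂ) ⊗ₖ (Matrix.scalar m' z - B)) *
      (Matrix.scalar (m × m') (z - t) - D ⊗ₖ J) =
      (z - t) • (Matrix.scalar (m × m') z - (D ⊗ₖ J + (1 : Matrix m m ℂ) ⊗ₖ B)) := by
    have h1 : Matrix.scalar (m × m') (z - t) = (z - t) • (1 : Matrix (m × m') (m × m') ℂ) := by
      rw [Matrix.smul_one_eq_diagonal]; rfl
    have h2 : Matrix.scalar (m × m') z = (1 : Matrix m m ℂ) ⊗ₖ (z • (1 : Matrix m' m' ℂ)) := by
      rw [Matrix.kronecker_smul, Matrix.one_kronecker_one, Matrix.smul_one_eq_diagonal]; rfl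
    have h3 : Matrix.scalar m' z = z • (1 : Matrix m' m' ℂ) := by
      rw [Matrix.smul_one_eq_diagonal]; rfl
    have h4 : (1 : Matrix m m ℂ) ⊗ₖ (z • (1 : Matrix m' m' ℂ) - B) =
      (1 : Matrix m m ℂ) ⊗ₖ (z • (1 : Matrix m' m' ℂ)) - (1 : Matrix m m ℂ) ⊗ₖ B := by
      ext ⟨i, i'⟩ ⟨j, j'⟩
      simp [mul_sub]
    rw [h1, h2, h3, mul_sub, ← Matrix.mul_kronecker_mul, one_mul, sub_mul, hBJ, smul_mul_assoc,
      one_mul, ← sub_smul, Matrix.kronecker_smul, h4, mul_smul_comm, mul_one, ← smul_sub]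
    congr 1
    abel
  have hdet := congrArg Matrix.det hfac
  rw [Matrix.det_mul, Matrix.det_kronecker, Matrix.det_one, one_pow, one_mul, Matrix.det_smul,
    ← Matrix.eval_charpoly, ← Matrix.eval_charpoly, ← Matrix.eval_charpoly] at hdet
  have hJD := congrArg (Polynomial.eval (z - t)) (charpoly_kronecker_ones (m' := m') D)
  rw [eval_mul, eval_mul, eval_pow, eval_pow, eval_X] at hJD
  refine mul_left_cancel₀ (pow_ne_zero (Fintype.card (m × m')) (sub_ne_zero.mpr hz)) ?_
  linear_combination (-(z - t) ^ Fintype.card m) * hdet + B.charpoly.eval z ^ Fintype.card m * hJD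

theorem charpoly_kronecker_add_mul [Nonempty m'] (D : Matrix m m ℂ) {B : Matrix m' m' ℂ} {t : ℂ}
    (hB : B *ᵥ 1 = t • (1 : m' → ℂ)) :
    (X - C t) ^ Fintype.card m *
      (D ⊗ₖ (Matrix.of fun _ _ => 1) + (1 : Matrix m m ℂ) ⊗ₖ B).charpoly =
      B.charpoly ^ Fintype.card m *
        ((D.charpoly.roots.map fun d => (Fintype.card m' : ℂ) * d + t).map fun a => X - C a).prod := by
  -- The evaluated identity is known only for z ≠ t, which is still infinitely many points.
  refine eq_of_infinite_eval_eq _ _ ((Set.finite_singleton t).infinite_compl.mono fun z hz => ?_)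
  have := eval_charpoly_kronecker_add D hB (z := z) hz
  rw [eval_charpoly_smul_eq_prod D (by simp)] at this
  simpa [eval_multiset_prod, Multiset.map_map, sub_sub, add_comm] using this

theorem spec_kronecker_add [Nonempty m'] (D : Matrix m m ℝ) {B : Matrix m' m' ℝ} {t : ℂ}
    (hB : toComplex B *ᵥ 1 = t • (1 : m' → ℂ)) (ht : t ∈ spec B) :
    spec (D ⊗ₖ allOnes m' + (1 : Matrix m m ℝ) ⊗ₖ B) =
      (spec D).map (fun d => (Fintype.card m' : ℂ) * d + t) +
        Fintype.card m • (spec B).erase t := by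
  have h := congrArg roots (charpoly_kronecker_add_mul (toComplex D) hB)
  rw [roots_mul (mul_ne_zero (pow_ne_zero _ (X_sub_C_ne_zero t)) (Matrix.charpoly_monic _).ne_zero),
    roots_mul (mul_ne_zero (pow_ne_zero _ (Matrix.charpoly_monic _).ne_zero)
      (monic_multiset_prod_of_monic _ _ fun a _ => monic_X_sub_C a).ne_zero),
    roots_pow, roots_pow, roots_X_sub_C, roots_multiset_prod_X_sub_C, ← toComplex_kronecker_add] at h
  change _ + spec _ = _ • spec B + (spec D).map _ at h
  -- One t from each copy of `spec B` cancels the roots of the factor (X - t)^n.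
  rw [← Multiset.cons_erase ht, ← Multiset.singleton_add, smul_add, add_assoc] at h
  rw [add_left_cancel h, add_comm]

end RealMatrix

/-! ### Maximum principle and simplicity of the row sum -/

namespace RealMatrix
open Matrix

/-- For a real matrix `B` with constant row sums `t` and positive off-diagonal entries, if
`B x - t x` is a constant vector, then `x` is a constant vector. -/
theorem eq_of_mulVec_sub_eq_const {m : Type*} [Fintype m] {B : Matrix m m ℝ} {t : ℝ}
    (hrow : ∀ i, ∑ j, B i j = t) (hpos : ∀ i j, i ≠ j → 0 < B i j) {x : m → ℝ} {c : ℝ}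
    (hx : ∀ i, ∑ j, B i j * x j - t * x i = c) (i j : m) : x i = x j := by
  have : Nonempty m := ⟨i⟩
  have key : ∀ i, ∑ j, B i j * (x j - x i) = c := fun i => by
    rw [← hx i, ← hrow i, Finset.sum_mul, ← Finset.sum_sub_distrib]
    exact Finset.sum_congr rfl fun j _ => by ring
  -- The sum in `key` is nonpositive at a maximum and nonnegative at a minimum, so c = 0 and every
  -- term at the maximum vanishes.
  obtain ⟨a, ha⟩ := Finite.exists_max x
  obtain ⟨b, hb⟩ := Finite.exists_min x
  have hterm : ∀ j, B a j * (x j - x a) ≤ 0 := fun j => by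
    rcases eq_or_ne a j with rfl | h
    · simp
    · exact mul_nonpos_of_nonneg_of_nonpos (hpos a j h).le (sub_nonpos.mpr (ha j))
  have hterm' : ∀ j, 0 ≤ B b j * (x j - x b) := fun j => by
    rcases eq_or_ne b j with rfl | h
    · simp
    · exact mul_nonneg (hpos b j h).le (sub_nonneg.mpr (hb j))
  have hc : c ≤ 0 := key a ▸ Finset.sum_nonpos fun j _ => hterm j
  have hc' : 0 ≤ c := key b ▸ Finset.sum_nonneg fun j _ => hterm' j
  have h0 := (Finset.sum_eq_zero_iff_of_nonpos fun j _ => hterm j).mp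
    ((key a).trans (le_antisymm hc hc'))
  have hall : ∀ j, x j = x a := fun j => by
    rcases eq_or_ne a j with rfl | h
    · rfl
    · exact sub_eq_zero.mp ((mul_eq_zero.mp (h0 j (Finset.mem_univ j))).resolve_left (hpos a j h).ne')
  rw [hall i, hall j]

variable {m : Type*} [Fintype m] {B : Matrix m m ℝ} {t : ℝ}

theorem toComplex_mulVec_one (hrow : ∀ i, ∑ j, B i j = t) :
    toComplex B *ᵥ 1 = (t : ℂ) • (1 : m → ℂ) := by
  ext i
  simp [Matrix.mulVec, dotProduct, toComplex, ← hrow i]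

theorem eq_of_toComplex_mulVec_sub_eq_const (hrow : ∀ i, ∑ j, B i j = t)
    (hpos : ∀ i j, i ≠ j → 0 < B i j) {x : m → ℂ} {c : ℂ}
    (hx : toComplex B *ᵥ x - (t : ℂ) • x = c • (1 : m → ℂ)) (i j : m) : x i = x j := by
  refine Complex.ext ?_ ?_
  · refine eq_of_mulVec_sub_eq_const hrow hpos (x := fun i => (x i).re) (c := c.re) (fun i => ?_) i j
    have := congrArg Complex.re (congrFun hx i)
    simpa [Matrix.mulVec, dotProduct, toComplex] using this
  · refine eq_of_mulVec_sub_eq_const hrow hpos (x := fun i => (x i).im) (c := c.im) (fun i => ?_) i j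
    have := congrArg Complex.im (congrFun hx i)
    simpa [Matrix.mulVec, dotProduct, toComplex] using this

theorem toComplex_mulVec_const (hrow : ∀ i, ∑ j, B i j = t) {x : m → ℂ}
    (hx : ∀ i j, x i = x j) : toComplex B *ᵥ x = (t : ℂ) • x := by
  cases isEmpty_or_nonempty m
  · exact Subsingleton.elim _ _
  obtain ⟨a⟩ := ‹Nonempty m›
  have : x = x a • 1 := by
    ext i
    simp [hx i a]
  rw [this, Matrix.mulVec_smul, toComplex_mulVec_one hrow, smul_comm]

variable [DecidableEq m]

theorem eigenspace_eq_span_one (hrow : ∀ i, ∑ j, B i j = t) (hpos : ∀ i j, i ≠ j → 0 < B i j) :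
    eigenspace B (t : ℂ) = Submodule.span ℂ {1} := by
  ext x
  rw [eigenspace, Module.End.mem_eigenspace_iff, Matrix.toLin'_apply, Submodule.mem_span_singleton]
  constructor
  · intro hx
    have hconst := eq_of_toComplex_mulVec_sub_eq_const hrow hpos (x := x) (c := 0) (by simp [hx])
    cases isEmpty_or_nonempty m
    · exact ⟨0, Subsingleton.elim _ _⟩
    obtain ⟨a⟩ := ‹Nonempty m›
    exact ⟨x a, funext fun i => by simp [hconst i a]⟩
  · rintro ⟨a, rfl⟩
    exact toComplex_mulVec_const hrow fun i j => by simp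

/-- The row sum of a matrix with positive off-diagonal entries is a simple eigenvalue. -/
theorem count_spec_rowSum [Nonempty m] (hrow : ∀ i, ∑ j, B i j = t)
    (hpos : ∀ i j, i ≠ j → 0 < B i j) : (spec B).count (t : ℂ) = 1 := by
  set f : Module.End ℂ (m → ℂ) := Matrix.toLin' (toComplex B)
  have hE : f.eigenspace (t : ℂ) = Submodule.span ℂ {1} := eigenspace_eq_span_one hrow hpos
  -- No Jordan chain: if (B - t)x is an eigenvector or zero, it is a constant vector, so x is
  -- constant and itself satisfies Bx = tx.
  have hmax : f.maxGenEigenspace (t : ℂ) = f.eigenspace (t : ℂ) := by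
    refine le_antisymm (fun x hx => ?_) (f.genEigenspace _ |>.mono le_top)
    rw [Module.End.mem_maxGenEigenspace] at hx
    obtain ⟨k, hk⟩ := hx
    induction k generalizing x with
    | zero => simp_all
    | succ k ih =>
      rw [pow_succ, Module.End.mul_apply] at hk
      have h1 := ih _ hk
      rw [hE, Submodule.mem_span_singleton] at h1
      obtain ⟨c, hc⟩ := h1
      have h2 : toComplex B *ᵥ x - (t : ℂ) • x = c • (1 : m → ℂ) := by
        rw [hc]
        simp [f]
      rw [Module.End.mem_eigenspace_iff]
      exact toComplex_mulVec_const hrow (eq_of_toComplex_mulVec_sub_eq_const hrow hpos h2)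
  have := LinearMap.finrank_maxGenEigenspace_eq f (t : ℂ)
  rw [hmax, hE, Matrix.charpoly_toLin', finrank_span_singleton one_ne_zero] at this
  rw [spec, Polynomial.count_roots, ← this]

end RealMatrix

/-! ### Eigenspaces of D ⊗ J + I ⊗ B -/

namespace RealMatrix
open Matrix

theorem perpOnes_iff {m : Type*} [Fintype m] {S : Submodule ℂ (m → ℂ)} :
    PerpOnes S ↔ ∀ y ∈ S, ∑ i, y i = 0 := by
  refine forall₂_congr fun y _ => ?_
  rw [dotProduct_one]
  simp only [Pi.star_apply, ← star_sum, star_eq_zero]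

variable {m m' : Type*} [Fintype m] [DecidableEq m] [Fintype m'] [DecidableEq m']

theorem mem_eigenspace {A : Matrix m m ℝ} {z : ℂ} {x : m → ℂ} :
    x ∈ eigenspace A z ↔ toComplex A *ᵥ x = z • x := by
  rw [eigenspace, Module.End.mem_eigenspace_iff, Matrix.toLin'_apply]

theorem mem_spec_iff {A : Matrix m m ℝ} {z : ℂ} : z ∈ spec A ↔ eigenspace A z ≠ ⊥ := by
  rw [spec, Polynomial.mem_roots (Matrix.charpoly_monic _).ne_zero, ← Matrix.charpoly_toLin',
    ← Module.End.hasEigenvalue_iff_isRoot_charpoly]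
  rfl

theorem gmult_eq_zero {A : Matrix m m ℝ} {z : ℂ} (h : z ∉ spec A) : gmult A z = 0 := by
  rw [mem_spec_iff, not_not] at h
  rw [gmult, h, finrank_bot]

theorem eigenspace_eq_ker (A : Matrix m m ℝ) (z : ℂ) :
    eigenspace A z = LinearMap.ker (Matrix.toLin' (toComplex A) - z • LinearMap.id) := by
  ext x
  simp [mem_eigenspace, sub_eq_zero]

theorem mem_eigenspace_kronecker_add {D : Matrix m m ℝ} {B : Matrix m' m' ℝ} {z : ℂ}
    {x : m × m' → ℂ} :
    x ∈ eigenspace (D ⊗ₖ allOnes m' + (1 : Matrix m m ℝ) ⊗ₖ B) z ↔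
      ∀ i, toComplex B *ᵥ (fun j => x (i, j)) - z • (fun j => x (i, j)) =
        -(toComplex D *ᵥ fun k => ∑ j, x (k, j)) i • (1 : m' → ℂ) := by
  rw [mem_eigenspace, toComplex_kronecker_add, funext_iff, Prod.forall]
  refine forall_congr' fun i => ?_
  rw [funext_iff]
  refine forall_congr' fun i' => ?_
  have h1 : ((toComplex D ⊗ₖ (Matrix.of fun _ _ => 1 : Matrix m' m' ℂ)) *ᵥ x) (i, i') =
      (toComplex D *ᵥ fun k => ∑ j, x (k, j)) i := by
    simp [mulVec, dotProduct, Fintype.sum_prod_type, Finset.mul_sum]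
  have h2 : (((1 : Matrix m m ℂ) ⊗ₖ toComplex B) *ᵥ x) (i, i') =
      (toComplex B *ᵥ (fun j => x (i, j))) i' := by
    simp [mulVec, dotProduct, Fintype.sum_prod_type, Matrix.one_apply]
  rw [add_mulVec, Pi.add_apply, h1, h2]
  simp only [Pi.smul_apply, Pi.sub_apply, Pi.one_apply, smul_eq_mul, mul_one]
  constructor <;> intro h <;> linear_combination h

/-- Sums of a vector that is constant on each block and a vector whose blocks lie in `E`. -/
noncomputable def blockSum (m : Type*) (E : Submodule ℂ (m' → ℂ)) : (m → ℂ) × (m → E) →ₗ[ℂ] m × m' → ℂ where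
  toFun p q := p.1 q.1 + (p.2 q.1 : m' → ℂ) q.2
  map_add' p p' := by
    ext q
    simp
    ring
  map_smul' a p := by
    ext q
    simp
    ring

/-- The sums of the entries of each block. -/
noncomputable def entrySum (m : Type*) (E : Submodule ℂ (m' → ℂ)) : (m → E) →ₗ[ℂ] m → ℂ where
  toFun y i := ∑ j, (y i : m' → ℂ) j
  map_add' y y' := by
    ext i
    simp [Finset.sum_add_distrib]
  map_smul' a y := by
    ext i
    simp [Finset.mul_sum]

/-- The condition on `(c, y)` for `blockSum m E (c, y)` to be an eigenvector of the product. -/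
noncomputable def eigenCondition (D : Matrix m m ℝ) (a zt : ℂ) (E : Submodule ℂ (m' → ℂ)) :
    (m → ℂ) × (m → E) →ₗ[ℂ] m → ℂ :=
  LinearMap.coprod (Matrix.toLin' (toComplex D) - zt • LinearMap.id)
    (a⁻¹ • (Matrix.toLin' (toComplex D)).comp (entrySum m E))

/-- The vector 1 belongs to the eigenvalue t ≠ z, so constants meet the eigenspace for z only in 0.
-/
theorem blockSum_injective {m : Type*} {B : Matrix m' m' ℝ} {t z : ℂ} [Nonempty m']
    (hB : toComplex B *ᵥ 1 = t • (1 : m' → ℂ)) (hz : z ≠ t) :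
    Function.Injective (blockSum m (eigenspace B z)) := by
  rw [← LinearMap.ker_eq_bot, LinearMap.ker_eq_bot']
  rintro ⟨c, y⟩ h
  have hy : ∀ i, (y i : m' → ℂ) = -c i • (1 : m' → ℂ) := fun i => funext fun j => by
    have := congrFun h (i, j)
    simp only [blockSum, LinearMap.coe_mk, AddHom.coe_mk, Pi.zero_apply] at this
    simpa using eq_neg_of_add_eq_zero_right this
  have hc : ∀ i, c i = 0 := fun i => by
    have h1 := mem_eigenspace.mp (y i).2
    rw [hy i, mulVec_smul, hB] at h1
    have h2 := congrFun h1 (Classical.arbitrary m')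
    simp only [Pi.smul_apply, Pi.one_apply, smul_eq_mul, mul_one] at h2
    have h3 : (z - t) * c i = 0 := by linear_combination h2
    exact (mul_eq_zero.mp h3).resolve_left (sub_ne_zero.mpr hz)
  refine Prod.ext (funext hc) (funext fun i => Subtype.ext ?_)
  simp [hy i, hc i]

theorem eigenspace_kronecker_add_of_ne [Nonempty m'] {D : Matrix m m ℝ} {B : Matrix m' m' ℝ}
    {t z zt : ℂ} (hB : toComplex B *ᵥ 1 = t • (1 : m' → ℂ)) (hz : z ≠ t)
    (hzt : zt = (z - t) / Fintype.card m') :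
    eigenspace (D ⊗ₖ allOnes m' + (1 : Matrix m m ℝ) ⊗ₖ B) z =
      (LinearMap.ker (eigenCondition D (Fintype.card m') zt (eigenspace B z))).map
        (blockSum m (eigenspace B z)) := by
  have hcard : (Fintype.card m' : ℂ) ≠ 0 := by simp
  have hz0 : z - t ≠ 0 := sub_ne_zero.mpr hz
  have hzt' : z - t = Fintype.card m' * zt := by rw [hzt]; field_simp
  have key : ∀ (c : m → ℂ) (y : m → eigenspace B z),
      blockSum m (eigenspace B z) (c, y) ∈
        eigenspace (D ⊗ₖ allOnes m' + (1 : Matrix m m ℝ) ⊗ₖ B) z ↔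
      (c, y) ∈ LinearMap.ker (eigenCondition D (Fintype.card m') zt (eigenspace B z)) := by
    intro c y
    rw [mem_eigenspace_kronecker_add, LinearMap.mem_ker, funext_iff]
    refine forall_congr' fun i => ?_
    have h1 : (fun j => blockSum m (eigenspace B z) (c, y) (i, j)) = c i • 1 + (y i : m' → ℂ) := by
      ext j
      simp [blockSum]
    have h2 : (fun k => ∑ j, blockSum m (eigenspace B z) (c, y) (k, j)) =
        (Fintype.card m' : ℂ) • c + entrySum m _ y := by
      ext k
      simp [blockSum, entrySum, Finset.sum_add_distrib]
    rw [h1, h2, mulVec_add, mem_eigenspace.mp (y i).2, mulVec_smul, hB, mulVec_add, mulVec_smul]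
    have h3 : c i • t • (1 : m' → ℂ) + z • (y i : m' → ℂ) - z • (c i • 1 + (y i : m' → ℂ)) =
        (-(z - t) * c i) • (1 : m' → ℂ) := by
      ext j
      simp
      ring
    rw [h3, (smul_left_injective ℂ (one_ne_zero : (1 : m' → ℂ) ≠ 0)).eq_iff, hzt']
    simp only [eigenCondition, LinearMap.coprod_apply, LinearMap.sub_apply, LinearMap.smul_apply,
      LinearMap.comp_apply, LinearMap.id_apply, Matrix.toLin'_apply, Pi.add_apply, Pi.sub_apply,
      Pi.smul_apply, smul_eq_mul, Pi.zero_apply]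
    constructor
    · intro h
      field_simp
      linear_combination h
    · intro h
      field_simp at h
      linear_combination h
  ext x
  rw [Submodule.mem_map]
  constructor
  · intro hx
    -- The constant particular solution of the block equation; subtracting it leaves an element of
    -- the eigenspace of B.
    let c : m → ℂ := fun i => (z - t)⁻¹ * (toComplex D *ᵥ fun k => ∑ j, x (k, j)) i
    have hy : ∀ i, (fun j => x (i, j) - c i) ∈ eigenspace B z := fun i => by
      have h1 := mem_eigenspace_kronecker_add.mp hx i
      have h2 : (toComplex D *ᵥ fun k => ∑ j, x (k, j)) i = (z - t) * c i := by
        simp only [c]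
        field_simp
      have h3 : (fun j => x (i, j) - c i) = (fun j => x (i, j)) - c i • (1 : m' → ℂ) := by
        ext j
        simp
      rw [mem_eigenspace, h3, mulVec_sub, mulVec_smul, hB, sub_eq_iff_eq_add.mp h1, h2]
      ext j
      simp
      ring
    have hxe : blockSum m (eigenspace B z) (c, fun i => ⟨_, hy i⟩) = x := by
      ext ⟨i, j⟩
      simp [blockSum]
    exact ⟨_, (key _ _).mp (by rwa [hxe]), hxe⟩
  · rintro ⟨⟨c, y⟩, h, rfl⟩
    exact (key c y).mpr h

theorem gmult_kronecker_add_add_finrank_range [Nonempty m'] {D : Matrix m m ℝ}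
    {B : Matrix m' m' ℝ} {t z zt : ℂ} (hB : toComplex B *ᵥ 1 = t • (1 : m' → ℂ)) (hz : z ≠ t)
    (hzt : zt = (z - t) / Fintype.card m') :
    gmult (D ⊗ₖ allOnes m' + (1 : Matrix m m ℝ) ⊗ₖ B) z +
      Module.finrank ℂ (LinearMap.range
        (eigenCondition D (Fintype.card m') zt (eigenspace B z))) =
      Fintype.card m + Fintype.card m * gmult B z := by
  rw [gmult, eigenspace_kronecker_add_of_ne hB hz hzt,
    ← (Submodule.equivMapOfInjective _ (blockSum_injective hB hz) _).finrank_eq, add_comm,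
    LinearMap.finrank_range_add_finrank_ker]
  simp [gmult, Module.finrank_pi_fintype]

theorem gmult_kronecker_add_of_range_eq_top [Nonempty m'] {D : Matrix m m ℝ}
    {B : Matrix m' m' ℝ} {t z zt : ℂ} (hB : toComplex B *ᵥ 1 = t • (1 : m' → ℂ)) (hz : z ≠ t)
    (hzt : zt = (z - t) / Fintype.card m')
    (h : LinearMap.range (eigenCondition D (Fintype.card m') zt (eigenspace B z)) = ⊤) :
    gmult (D ⊗ₖ allOnes m' + (1 : Matrix m m ℝ) ⊗ₖ B) z = Fintype.card m * gmult B z := by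
  have := gmult_kronecker_add_add_finrank_range (D := D) hB hz hzt
  rw [h, finrank_top, Module.finrank_fintype_fun_eq_card] at this
  omega

theorem gmult_kronecker_add_of_perpOnes [Nonempty m'] {D : Matrix m m ℝ}
    {B : Matrix m' m' ℝ} {t z zt : ℂ} (hB : toComplex B *ᵥ 1 = t • (1 : m' → ℂ)) (hz : z ≠ t)
    (hzt : zt = (z - t) / Fintype.card m') (h : PerpOnes (eigenspace B z)) :
    gmult (D ⊗ₖ allOnes m' + (1 : Matrix m m ℝ) ⊗ₖ B) z =
      Fintype.card m * gmult B z + gmult D zt := by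
  have := gmult_kronecker_add_add_finrank_range (D := D) hB hz hzt
  have h0 : entrySum m (eigenspace B z) = 0 := by
    refine LinearMap.ext fun y => funext fun i => ?_
    exact perpOnes_iff.mp h _ (y i).2
  rw [eigenCondition, LinearMap.range_coprod, h0, LinearMap.comp_zero, smul_zero,
    LinearMap.range_zero, sup_bot_eq] at this
  have hrn := LinearMap.finrank_range_add_finrank_ker
    (Matrix.toLin' (toComplex D) - zt • LinearMap.id)
  rw [← eigenspace_eq_ker, Module.finrank_fintype_fun_eq_card] at hrn
  change _ + gmult D zt = _ at hrn
  omega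

theorem range_eigenCondition_of_notMem_spec {m' : Type*} [Fintype m'] {D : Matrix m m ℝ}
    {a zt : ℂ} {E : Submodule ℂ (m' → ℂ)} (h : zt ∉ spec D) :
    LinearMap.range (eigenCondition D a zt E) = ⊤ := by
  rw [mem_spec_iff, not_not, eigenspace_eq_ker, LinearMap.ker_eq_bot_iff_range_eq_top] at h
  rw [eigenCondition, LinearMap.range_coprod, h, top_sup_eq]

theorem range_eigenCondition_of_not_perpOnes {m' : Type*} [Fintype m'] {D : Matrix m m ℝ}
    {a zt : ℂ} {E : Submodule ℂ (m' → ℂ)} (ha : a ≠ 0) (hzt : zt ≠ 0) (h : ¬ PerpOnes E) :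
    LinearMap.range (eigenCondition D a zt E) = ⊤ := by
  rw [perpOnes_iff] at h
  push Not at h
  obtain ⟨y, hy, hs⟩ := h
  rw [LinearMap.range_eq_top]
  intro b
  -- The y-part is given block sums -a u, so that the two Du terms cancel and -z̃u = b remains.
  set u : m → ℂ := -zt⁻¹ • b with hu
  refine ⟨(u, fun i => (-(a * u i) / ∑ j, y j) • ⟨y, hy⟩), ?_⟩
  have hsum : entrySum m E (fun i => (-(a * u i) / ∑ j, y j) • ⟨y, hy⟩) = -a • u := by
    ext i
    simp only [entrySum, LinearMap.coe_mk, AddHom.coe_mk, Submodule.coe_smul, Pi.smul_apply,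
      smul_eq_mul, ← Finset.mul_sum]
    field_simp
  rw [eigenCondition, LinearMap.coprod_apply, LinearMap.smul_apply, LinearMap.comp_apply, hsum]
  ext i
  simp [hu, ha, hzt, mulVec_neg, mulVec_smul]

/-- Here 1 is itself an eigenvector of B for z, so the splitting into constants and eigenvectors is
not unique. The maximum principle makes blocks constant instead, leaving Dc = 0. -/
theorem gmult_kronecker_add_of_eq [Nonempty m'] {D : Matrix m m ℝ} {B : Matrix m' m' ℝ} {t : ℝ}
    (hrow : ∀ i, ∑ j, B i j = t) (hpos : ∀ i j, i ≠ j → 0 < B i j) :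
    gmult (D ⊗ₖ allOnes m' + (1 : Matrix m m ℝ) ⊗ₖ B) (t : ℂ) = gmult D 0 := by
  let f : (m → ℂ) →ₗ[ℂ] m × m' → ℂ := LinearMap.funLeft ℂ ℂ Prod.fst
  have hf : Function.Injective f := LinearMap.funLeft_injective_of_surjective _ _ _ Prod.fst_surjective
  have key : ∀ c : m → ℂ, f c ∈ eigenspace (D ⊗ₖ allOnes m' + (1 : Matrix m m ℝ) ⊗ₖ B) (t : ℂ) ↔
      c ∈ eigenspace D 0 := by
    intro c
    rw [mem_eigenspace_kronecker_add, mem_eigenspace, funext_iff]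
    refine forall_congr' fun i => ?_
    have h1 : (fun k => ∑ j : m', f c (k, j)) = (Fintype.card m' : ℂ) • c := by
      ext k
      simp [f]
    have h2 : toComplex B *ᵥ (fun j => f c (i, j)) = (t : ℂ) • (fun j => f c (i, j)) :=
      toComplex_mulVec_const hrow fun j k => by simp [f]
    rw [h1, h2, sub_self, mulVec_smul, eq_comm, smul_eq_zero_iff_left one_ne_zero]
    simp
  have h : eigenspace (D ⊗ₖ allOnes m' + (1 : Matrix m m ℝ) ⊗ₖ B) (t : ℂ) =
      (eigenspace D 0).map f := by
    ext x
    rw [Submodule.mem_map]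
    constructor
    · intro hx
      have hconst : ∀ i j k, x (i, j) = x (i, k) := fun i =>
        eq_of_toComplex_mulVec_sub_eq_const hrow hpos (mem_eigenspace_kronecker_add.mp hx i)
      have hxe : f (fun i => x (i, Classical.arbitrary m')) = x := by
        ext ⟨i, j⟩
        exact hconst i _ j
      exact ⟨_, (key _).mp (hxe.symm ▸ hx), hxe⟩
    · rintro ⟨c, hc, rfl⟩
      exact (key c).mpr hc
  rw [gmult, h, ← (Submodule.equivMapOfInjective f hf _).finrank_eq, gmult]

end RealMatrix

theorem mainTheorem7 {V V' : Type*} [Fintype V] [DecidableEq V] [Fintype V'] [DecidableEq V']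
    (Γ : Digraph V) (Γ' : Digraph V') (hΓ : Γ.Loopless) (hΓ' : Γ'.Loopless)
    (hc : Γ.StronglyConnected) (hc' : Γ'.StronglyConnected)
    (t' : ℕ) (ht' : Γ'.IsTransmissionRegular t') (hdiam : Γ'.ediam ≤ Γ.egirth) :
    (Γ.lexProd Γ').StronglyConnected ∧
    (Γ.lexProd Γ').distMatrix =
      Γ.distMatrix ⊗ₖ RealMatrix.allOnes V' + (1 : Matrix V V ℝ) ⊗ₖ Γ'.distMatrix ∧
    (t' : ℂ) ∈ RealMatrix.spec Γ'.distMatrix ∧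
    RealMatrix.spec (Γ.lexProd Γ').distMatrix =
      (RealMatrix.spec Γ.distMatrix).map (fun d => (Fintype.card V' : ℂ) * d + (t' : ℂ)) +
        Fintype.card V • (RealMatrix.spec Γ'.distMatrix).erase (t' : ℂ) ∧
    ∀ z zt : ℂ, zt = (z - (t' : ℂ)) / (Fintype.card V' : ℂ) →
      ∀ g g' : ℕ, g = RealMatrix.gmult Γ.distMatrix zt → g' = RealMatrix.gmult Γ'.distMatrix z →
      (z ∉ (RealMatrix.spec Γ'.distMatrix).erase (t' : ℂ) → zt ∈ RealMatrix.spec Γ.distMatrix →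
        RealMatrix.gmult (Γ.lexProd Γ').distMatrix z = g) ∧
      (z ∈ (RealMatrix.spec Γ'.distMatrix).erase (t' : ℂ) → zt ∉ RealMatrix.spec Γ.distMatrix →
        RealMatrix.gmult (Γ.lexProd Γ').distMatrix z = Fintype.card V * g') ∧
      (z ∈ (RealMatrix.spec Γ'.distMatrix).erase (t' : ℂ) → zt ∈ RealMatrix.spec Γ.distMatrix →
        RealMatrix.PerpOnes (RealMatrix.eigenspace Γ'.distMatrix z) →
        RealMatrix.gmult (Γ.lexProd Γ').distMatrix z = Fintype.card V * g' + g) ∧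
      (z ∈ (RealMatrix.spec Γ'.distMatrix).erase (t' : ℂ) → zt ∈ RealMatrix.spec Γ.distMatrix →
        ¬ RealMatrix.PerpOnes (RealMatrix.eigenspace Γ'.distMatrix z) →
        RealMatrix.gmult (Γ.lexProd Γ').distMatrix z = Fintype.card V * g') ∧
      (z ∉ (RealMatrix.spec Γ'.distMatrix).erase (t' : ℂ) → zt ∉ RealMatrix.spec Γ.distMatrix →
        RealMatrix.gmult (Γ.lexProd Γ').distMatrix z = 0) := by
  have := hc'.1
  have hrow : ∀ i, ∑ j, Γ'.distMatrix i j = (t' : ℝ) := fun i => by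
    have := ht' i
    rw [Digraph.transmission] at this
    simp [Digraph.distMatrix, ← this]
  have hpos : ∀ i j, i ≠ j → 0 < Γ'.distMatrix i j := fun i j hij => by
    simpa [Digraph.distMatrix] using hc'.dist_pos hij
  have hone : (RealMatrix.toComplex Γ'.distMatrix).mulVec 1 = (t' : ℂ) • (1 : V' → ℂ) := by
    simpa using RealMatrix.toComplex_mulVec_one hrow
  have hcount : (RealMatrix.spec Γ'.distMatrix).count (t' : ℂ) = 1 := by
    simpa using RealMatrix.count_spec_rowSum hrow hpos
  have hmem : (t' : ℂ) ∈ RealMatrix.spec Γ'.distMatrix :=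
    Multiset.one_le_count_iff_mem.mp hcount.ge
  have hD := Digraph.distMatrix_lexProd hc hc' hdiam
  refine ⟨hc.lexProd hc', hD, hmem, hD ▸ RealMatrix.spec_kronecker_add _ hone hmem, ?_⟩
  rintro z zt hzt _ _ rfl rfl
  rw [hD]
  -- For z = t' simplicity gives z ∉ S', so only the first and last cases arise, with z̃ = 0.
  by_cases hz : z = t'
  · subst hz
    have hnot : (t' : ℂ) ∉ (RealMatrix.spec Γ'.distMatrix).erase (t' : ℂ) := by
      rw [← Multiset.count_eq_zero, Multiset.count_erase_self, hcount]
    have hg := RealMatrix.gmult_kronecker_add_of_eq (D := Γ.distMatrix) hrow hpos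
    rw [sub_self, zero_div] at hzt
    rw [Complex.ofReal_natCast, ← hzt] at hg
    exact ⟨fun _ _ => hg, fun h => (hnot h).elim, fun h => (hnot h).elim, fun h => (hnot h).elim,
      fun _ h => hg.trans (RealMatrix.gmult_eq_zero h)⟩
  · rw [Multiset.mem_erase_of_ne hz]
    have hzt0 : zt ≠ 0 := by
      rw [hzt]
      exact div_ne_zero (sub_ne_zero.mpr hz) (by simp)
    -- The eigenspace is zero, hence trivially orthogonal to 1.
    have hperp : z ∉ RealMatrix.spec Γ'.distMatrix →
        RealMatrix.gmult (Γ.distMatrix ⊗ₖ RealMatrix.allOnes V' +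
          (1 : Matrix V V ℝ) ⊗ₖ Γ'.distMatrix) z = RealMatrix.gmult Γ.distMatrix zt := fun h => by
      have hE := h
      rw [RealMatrix.mem_spec_iff, not_not] at hE
      rw [RealMatrix.gmult_kronecker_add_of_perpOnes hone hz hzt, RealMatrix.gmult_eq_zero h,
        mul_zero, zero_add]
      rw [hE, RealMatrix.perpOnes_iff]
      rintro y hy
      simp [(Submodule.mem_bot ℂ).mp hy]
    refine ⟨fun h _ => hperp h, fun _ h => ?_, fun _ _ h => ?_, fun _ _ h => ?_, fun h h' => ?_⟩
    · exact RealMatrix.gmult_kronecker_add_of_range_eq_top hone hz hzt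
        (RealMatrix.range_eigenCondition_of_notMem_spec h)
    · exact RealMatrix.gmult_kronecker_add_of_perpOnes hone hz hzt h
    · exact RealMatrix.gmult_kronecker_add_of_range_eq_top hone hz hzt
        (RealMatrix.range_eigenCondition_of_not_perpOnes (by simp) hzt0 h)
    · exact (hperp h).trans (RealMatrix.gmult_eq_zero h')
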